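/- Let $\mathcal C$ be a semi-abelian category, that is, a pointed, Barr exact and protomodular category with binary coproducts. Notation: * For objects $B,X$, let $\kappa\colon B\flat X\to B+X$ be the kernel of $[1_B,0]\colon B+X\to B$. The functor $B\flat(-)$ is a monad, with unit $\eta\colon X\to B\flat X$ determined by $\kappa\eta=\iota_2$ and multiplication $\mu\colon B\flat(B\flat X)\to B\flat X$ determined by $\kappa\mu=[\iota_1,\kappa]\,\kappa_{B,B\flat X}$. An *action* of $B$ on $X$ is an arrow $\xi\colon B\flat X\to X$ that is an algebra structure for this monad: $\xi\eta=1_X$ and $\xi\mu=\xi\,(1_B\flat\xi)$. The *conjugation action* of $X$ on itself is $\chi_X=[1_X,1_X]\circ\kappa\colon X\flat X\to X$. * The split short exact sequence $0\to X\xrightarrow{k}X\rtimes_\xi B\underset{e}{\overset{d}{\rightleftarrows}}B\to0$ induced by an action $\xi$ is obtained from a coequaliser $q\colon B+X\to X\rtimes_\xi B$ of $\kappa$ and $\iota_2\circ\xi$ by putting $k=q\iota_2$, $e=q\iota_1$ and $d\circ q=[1_B,0]$. * For $f\colon X\to Y$ and $g\colon B\to Y$, the *twisted commutator* $[f,g]_\xi$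 is the image (a subobject of $Y$) of the composite of the kernel of $[k,e]\colon X+B\to X\rtimes_\xi B$ with $[f,g]\colon X+B\to Y$. It *vanishes* if it is the zero subobject. * For an arrow $\partial\colon X\to B$ and an action $\xi$ of $B$ on $X$, the pair $(\partial,\xi)$ is an *internal crossed module* if there is an arrow $c\colon X\rtimes_\xi B\to B$ with $c\circ e=1_B$ and $c\circ k=\partial$ such that the reflexive graph $(X\rtimes_\xi B,B,d,c,e)$ admits an internal groupoid structure. * Two arrows $f\colon X\to Y$, $g\colon B\to Y$ *(Huq-)commute* if there is $\varphi\colon X\times B\to Y$ with $\varphi\circ(1_X,0)=f$ and $\varphi\circ(0,1_B)=g$. Two equivalence relations $(r_1,r_2)\colon R\rightrightarrows X$ and $(s_1,s_2)\colon S\rightrightarrows X$, with reflexivity arrows $\Delta_R$ and $\Delta_S$, *(Smith-)commute* if there is $\theta\colon R\times_XS\to X$, where $R\times_X S$ is the pullback of $r_2$ and $s_1$, with $\theta\circ(1_R,\Delta_Sr_2)=r_1$ and $\theta\circ(\Delta_Rs_1,1_S)=s_2$. The *normalisation* of $(r_1,r_2)$ is $r_2\circ\ker r_1$. The category $\mathcal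 C$ satisfies the *Smith-is-Huq condition* (SH) if two effective equivalence relations on the same object commute if and only if their normalisations commute. **Theorem.** Suppose that $\mathcal C$ satisfies (SH). Let $\partial\colon X\to B$ be an arrow and $\xi$ an action of $B$ on $X$, with induced split short exact sequence given by $(k,d,e)$. Then $(\partial,\xi)$ is an internal crossed module if and only if both twisted commutators $[\partial,1_B]_\xi$ and $[k,e\circ\partial]_{\chi_X}$ vanish. -/

import Mathlib

open CategoryTheory CategoryTheory.Limits

universe v u

/-- A *semi-abelian category*: a pointed category with binary coproducts that is Barr exact
(regular, and every internal equivalence relation is effective) and protomodular. In the presence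
of a zero object, protomodularity is the Split Short Five Lemma: a morphism of split short exact
sequences whose two outer components are isomorphisms is an isomorphism. -/
class SemiAbelian (C : Type u) [Category.{v} C] [HasZeroMorphisms C] : Prop
    extends HasZeroObject C, HasBinaryCoproducts C, Regular C where
  isEffective {R A : C} (p₁ p₂ : R ⟶ A) :
    IsEquivalenceRelation p₁ p₂ → IsEffectiveEquivalenceRelation p₁ p₂
  splitShortFive {K A B K' A' B' : C} {k : K ⟶ A} {p : A ⟶ B} {s : B ⟶ A}
    {k' : K' ⟶ A'} {p' : A' ⟶ B'} {s' : B' ⟶ A'} {x : K ⟶ K'} {a : A ⟶ A'} {b : B ⟶ B'}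
    (w : k ≫ p = 0) (_ : Nonempty (IsLimit (KernelFork.ofι k w))) (_ : s ≫ p = 𝟙 B)
    (w' : k' ≫ p' = 0) (_ : Nonempty (IsLimit (KernelFork.ofι k' w'))) (_ : s' ≫ p' = 𝟙 B')
    (_ : k ≫ a = x ≫ k') (_ : p ≫ b = a ≫ p') (_ : s ≫ a = b ≫ s')
    (_ : IsIso x) (_ : IsIso b) : IsIso a

namespace SemiAbelian

attribute [local simp] prod.lift_fst prod.lift_fst_assoc prod.lift_snd prod.lift_snd_assoc
  pullback.lift_fst pullback.lift_fst_assoc pullback.lift_snd pullback.lift_snd_assoc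
  coprod.inl_desc coprod.inl_desc_assoc coprod.inr_desc coprod.inr_desc_assoc
  coprod.inl_map coprod.inl_map_assoc coprod.inr_map coprod.inr_map_assoc
  coequalizer.π_desc coequalizer.π_desc_assoc kernel.lift_ι kernel.lift_ι_assoc

variable {C : Type u} [Category.{v} C] [HasZeroMorphisms C] [SemiAbelian C]

/-! ### Existence of coequalisers -/

lemma isLimit_kernel_of_pullback {A B D M : C} {p : A ⟶ B} {q : D ⟶ B} {t : B ⟶ D}
    (ht : t ≫ q = 𝟙 B) (m : M ⟶ pullback p q) [Mono m] (a : A ⟶ M)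
    (ha : a ≫ m = pullback.lift (𝟙 A) (p ≫ t) (by simp [ht])) :
    ∃ w : (kernel.ι p ≫ a) ≫ (m ≫ pullback.snd p q) = 0,
      Nonempty (IsLimit (KernelFork.ofι (kernel.ι p ≫ a) w)) := by
  have h1 : a ≫ m ≫ pullback.fst p q = 𝟙 A := by
    rw [← Category.assoc, ha, pullback.lift_fst]
  have h2 : a ≫ m ≫ pullback.snd p q = p ≫ t := by
    rw [← Category.assoc, ha, pullback.lift_snd]
  refine ⟨by rw [Category.assoc, h2, kernel.condition_assoc, zero_comp], ⟨?_⟩⟩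
  refine KernelFork.IsLimit.ofι _ _ (fun {T} z hz => kernel.lift p (z ≫ m ≫ pullback.fst p q) ?_)
    (fun {T} z hz => ?_) (fun {T} z hz l hl => ?_)
  · simp only [Category.assoc] at hz ⊢
    rw [pullback.condition]
    simpa using hz =≫ q
  · rw [← cancel_mono m]
    apply pullback.hom_ext
    · simp [h1]
    · simp only [Category.assoc] at hz ⊢
      refine Eq.trans ?_ hz.symm
      simp [h2]
  · rw [← cancel_mono (kernel.ι p), kernel.lift_ι, ← hl]
    simp [h1]

/-- The two canonical inclusions into a pullback of split epimorphisms are jointly extremally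
epic. -/
lemma isIso_of_mono_pullback {A B D M : C} {p : A ⟶ B} {s : B ⟶ A} {q : D ⟶ B} {t : B ⟶ D}
    (hs : s ≫ p = 𝟙 B) (ht : t ≫ q = 𝟙 B) (m : M ⟶ pullback p q) [Mono m]
    (a : A ⟶ M) (ha : a ≫ m = pullback.lift (𝟙 A) (p ≫ t) (by simp [ht]))
    (b : D ⟶ M) (hb : b ≫ m = pullback.lift (q ≫ s) (𝟙 D) (by simp [hs])) : IsIso m := by
  obtain ⟨w, hw⟩ := isLimit_kernel_of_pullback ht m a ha
  obtain ⟨w', hw'⟩ := isLimit_kernel_of_pullback ht (𝟙 (pullback p q)) (a ≫ m) (by simpa using ha)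
  refine splitShortFive (s := b) (s' := b ≫ m) (x := 𝟙 _) (b := 𝟙 _) w hw ?_ w' hw' ?_
    (by simp) (by simp) (by simp) inferInstance inferInstance
  · rw [← Category.assoc, hb, pullback.lift_snd]
  · rw [hb, Category.id_comp (pullback.snd p q), pullback.lift_snd]

/-- Reflexive relations are difunctional. -/
lemma difunctional {R X : C} {d c : R ⟶ X} (h : ReflexiveRelation d c) {T : C} (α β γ : T ⟶ R)
    (h₁ : α ≫ c = β ≫ c) (h₂ : β ≫ d = γ ≫ d) :
    ∃ δ : T ⟶ R, δ ≫ d = α ≫ d ∧ δ ≫ c = γ ≫ c := by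
  let p := pullback.snd c c
  let s : R ⟶ pullback c c := pullback.lift (𝟙 R) (𝟙 R) rfl
  let q := pullback.fst d d
  let t : R ⟶ pullback d d := pullback.lift (𝟙 R) (𝟙 R) rfl
  have hs : s ≫ p = 𝟙 R := pullback.lift_snd _ _ _
  have ht : t ≫ q = 𝟙 R := pullback.lift_fst _ _ _
  let i : R ⟶ X ⨯ X := prod.lift d c
  have : Mono i := ⟨fun f g hfg => h.right_cancellation f g
    (by simpa [i] using hfg =≫ prod.fst) (by simpa [i] using hfg =≫ prod.snd)⟩
  let j : pullback p q ⟶ X ⨯ X :=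
    prod.lift (pullback.fst p q ≫ pullback.fst c c ≫ d) (pullback.snd p q ≫ pullback.snd d d ≫ c)
  let m := pullback.snd i j
  let a : pullback c c ⟶ pullback i j :=
    pullback.lift (pullback.fst c c) (pullback.lift (𝟙 _) (p ≫ t) (by simp [ht])) (by
      apply Limits.prod.hom_ext
      · simp [i, j]
      · simp [i, j, t, p, pullback.condition])
  let b : pullback d d ⟶ pullback i j :=
    pullback.lift (pullback.snd d d) (pullback.lift (q ≫ s) (𝟙 _) (by simp [hs])) (by
      apply Limits.prod.hom_ext
      · simp [i, j, s, q, pullback.condition]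
      · simp [i, j])
  have : IsIso m := isIso_of_mono_pullback hs ht m a (pullback.lift_snd _ _ _)
    b (pullback.lift_snd _ _ _)
  let τ : T ⟶ pullback p q :=
    pullback.lift (pullback.lift α β h₁) (pullback.lift β γ h₂) (by simp [p, q])
  have hk : (τ ≫ inv m ≫ pullback.fst i j) ≫ i = τ ≫ j := by
    rw [Category.assoc, Category.assoc, pullback.condition]
    simp [m]
  refine ⟨τ ≫ inv m ≫ pullback.fst i j, ?_, ?_⟩
  · have := hk =≫ prod.fst
    simpa [i, j, τ] using this
  · have := hk =≫ prod.snd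
    simpa [i, j, τ] using this

/-- Semi-abelian categories are Mal'tsev categories. -/
lemma isEquivalenceRelation_of_reflexive {R X : C} {d c : R ⟶ X} (h : ReflexiveRelation d c) :
    IsEquivalenceRelation d c := by
  obtain ⟨σ, hσ₁, hσ₂⟩ := difunctional h (c ≫ h.r) (𝟙 R) (d ≫ h.r) (by simp) (by simp)
  obtain ⟨τ, hτ₁, hτ₂⟩ := difunctional h (pullback.fst c d) (pullback.fst c d ≫ c ≫ h.r)
    (pullback.snd c d) (by simp) (by simp [pullback.condition])
  exact ⟨⟨{ h with
    s := σ
    symmetry₁ := by simpa using hσ₁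
    symmetry₂ := by simpa using hσ₂
    c := pullback.cone c d
    isLimit := pullback.isLimit c d
    t := τ
    transitivity₁ := hτ₁
    transitivity₂ := hτ₂ }⟩⟩

instance : HasCoequalizers C := by
  suffices ∀ {A Y : C} (f g : A ⟶ Y), HasCoequalizer f g from
    hasCoequalizers_of_hasColimit_parallelPair C
  intro A Y f g
  let h : A ⨿ Y ⟶ Y ⨯ Y := prod.lift (coprod.desc f (𝟙 Y)) (coprod.desc g (𝟙 Y))
  let F := Regular.strongEpiMonoFactorisation h
  have : IsRegularEpi F.e := inferInstanceAs (IsRegularEpi (Regular.strongEpiMonoFactorisation h).e)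
  let d : F.I ⟶ Y := F.m ≫ prod.fst
  let c : F.I ⟶ Y := F.m ≫ prod.snd
  have hd : F.e ≫ d = coprod.desc f (𝟙 Y) := by
    rw [← Category.assoc, F.fac, prod.lift_fst]
  have hc : F.e ≫ c = coprod.desc g (𝟙 Y) := by
    rw [← Category.assoc, F.fac, prod.lift_snd]
  have hr : ReflexiveRelation d c :=
    { right_cancellation := fun Z a b h₁ h₂ => by
        rw [← cancel_mono F.m]
        apply Limits.prod.hom_ext
        · simpa [d] using h₁
        · simpa [c] using h₂
      r := coprod.inr ≫ F.e
      reflexivity₁ := by rw [Category.assoc, hd, coprod.inr_desc]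
      reflexivity₂ := by rw [Category.assoc, hc, coprod.inr_desc] }
  obtain ⟨⟨E⟩⟩ := isEffective d c (isEquivalenceRelation_of_reflexive hr)
  have hf : f = coprod.inl ≫ F.e ≫ d := by rw [hd, coprod.inl_desc]
  have hg : g = coprod.inl ≫ F.e ≫ c := by rw [hc, coprod.inl_desc]
  have hw : d ≫ E.π = c ≫ E.π := E.isPushout.w
  have key : ∀ {Z : C} (l : Y ⟶ Z), f ≫ l = g ≫ l → d ≫ l = c ≫ l := fun l hl => by
    rw [← cancel_epi F.e, reassoc_of% hd, reassoc_of% hc]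
    apply coprod.hom_ext <;> simp [hl]
  refine ⟨⟨⟨Cofork.ofπ E.π (by rw [hf, hg]; simp [hw]), ?_⟩⟩⟩
  refine Cofork.IsColimit.mk _ (fun s => E.isPushout.desc s.π s.π (key _ s.condition))
    (fun s => E.isPushout.inl_desc _ _ _) (fun s l hl => ?_)
  apply E.isPushout.hom_ext <;> rw [E.isPushout.inl_desc] <;> exact hl

noncomputable section

/-! ### Internal actions and their split short exact sequences -/

/-- The object `B ♭ X`: the kernel of `[1, 0] : B + X ⟶ B`. -/
abbrev flat (B X : C) : C := kernel (coprod.desc (𝟙 B) 0 : B ⨿ X ⟶ B)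

/-- The kernel inclusion `κ : B ♭ X ⟶ B + X`. -/
abbrev flatι (B X : C) : flat B X ⟶ B ⨿ X := kernel.ι (coprod.desc (𝟙 B) 0 : B ⨿ X ⟶ B)

/-- The action of `♭` on morphisms, the restriction of `g + f` to kernels. -/
def flatMap {B B' X X' : C} (g : B ⟶ B') (f : X ⟶ X') : flat B X ⟶ flat B' X' :=
  kernel.lift _ (flatι B X ≫ coprod.map g f) (by
    have : coprod.map g f ≫ coprod.desc (𝟙 B') 0 = coprod.desc (𝟙 B) (0 : X ⟶ B) ≫ g := by
      apply coprod.hom_ext <;> simp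
    rw [Category.assoc, this, kernel.condition_assoc, zero_comp])

/-- The unit `X ⟶ B ♭ X` of the monad `B ♭ -`, induced by the coproduct inclusion. -/
def flatUnit (B X : C) : X ⟶ flat B X :=
  kernel.lift _ coprod.inr (by simp)

/-- The multiplication `B ♭ (B ♭ X) ⟶ B ♭ X` of the monad `B ♭ -`, the restriction of
`[ι₁, κ] : B + (B ♭ X) ⟶ B + X` to kernels. -/
def flatMul (B X : C) : flat B (flat B X) ⟶ flat B X :=
  kernel.lift _ (flatι B (flat B X) ≫ coprod.desc coprod.inl (flatι B X)) (by
    have : coprod.desc coprod.inl (flatι B X) ≫ coprod.desc (𝟙 B) 0 =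
        coprod.desc (𝟙 B) (0 : flat B X ⟶ B) := by
      apply coprod.hom_ext <;> simp
    rw [Category.assoc, this, kernel.condition])

lemma flatMap_ι {B B' X X' : C} (g : B ⟶ B') (f : X ⟶ X') :
    flatMap g f ≫ flatι B' X' = flatι B X ≫ coprod.map g f := kernel.lift_ι _ _ _

lemma flatUnit_ι (B X : C) : flatUnit B X ≫ flatι B X = coprod.inr := kernel.lift_ι _ _ _

lemma flatMul_ι (B X : C) : flatMul B X ≫ flatι B X =
    flatι B (flat B X) ≫ coprod.desc coprod.inl (flatι B X) := kernel.lift_ι _ _ _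

/-- An *internal action* of `B` on `X`: an algebra structure on `X` for the monad `B ♭ -`. -/
structure Action (B X : C) where
  act : flat B X ⟶ X
  unit : flatUnit B X ≫ act = 𝟙 X
  assoc : flatMul B X ≫ act = flatMap (𝟙 B) act ≫ act

/-- The conjugation action of `X` on itself, `[1, 1] ∘ κ : X ♭ X ⟶ X`. -/
def conjAction (X : C) : Action X X where
  act := flatι X X ≫ coprod.desc (𝟙 X) (𝟙 X)
  unit := by rw [reassoc_of% flatUnit_ι, coprod.inr_desc]
  assoc := by
    rw [reassoc_of% flatMul_ι, reassoc_of% flatMap_ι]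
    congr 1
    apply coprod.hom_ext <;> simp

namespace Action

variable {B X : C} (ξ : Action B X)

/-- The semi-direct product `X ⋊ B`: the coequaliser of `κ` and `ι₂ ∘ ξ`. -/
def semidirect : C := coequalizer (flatι B X) (ξ.act ≫ coprod.inr)

/-- The quotient map `q : B + X ⟶ X ⋊ B`. -/
def q : B ⨿ X ⟶ ξ.semidirect := coequalizer.π (flatι B X) (ξ.act ≫ coprod.inr)

/-- The arrow `k : X ⟶ X ⋊ B` of the induced split short exact sequence. -/
def k : X ⟶ ξ.semidirect := coprod.inr ≫ ξ.q

/-- The section `e : B ⟶ X ⋊ B` of the induced split short exact sequence. -/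
def e : B ⟶ ξ.semidirect := coprod.inl ≫ ξ.q

/-- The split epimorphism `d : X ⋊ B ⟶ B` of the induced split short exact sequence, the arrow
with `d ∘ q = [1, 0]`. -/
def d : ξ.semidirect ⟶ B :=
  coequalizer.desc (coprod.desc (𝟙 B) 0) (by simp)

lemma q_d : ξ.q ≫ ξ.d = coprod.desc (𝟙 B) 0 := coequalizer.π_desc _ _

lemma e_d : ξ.e ≫ ξ.d = 𝟙 B := by rw [e, Category.assoc, q_d, coprod.inl_desc]

end Action

/-! ### Relative and twisted commutators -/

/-- The `(k, s)`-commutator of `f` and `g`: the image of the composite of the kernel of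
`[k, s] : X + B ⟶ A` with `[f, g] : X + B ⟶ Y`. -/
def relCommutator {X A B Y : C} (k : X ⟶ A) (s : B ⟶ A) (f : X ⟶ Y) (g : B ⟶ Y) : Subobject Y :=
  imageSubobject (kernel.ι (coprod.desc k s) ≫ coprod.desc f g)

/-- The commutator of `f` and `g` twisted by the action `ξ`. -/
def Action.commutator {B X Y : C} (ξ : Action B X) (f : X ⟶ Y) (g : B ⟶ Y) : Subobject Y :=
  relCommutator ξ.k ξ.e f g

/-! ### Internal groupoids and internal crossed modules -/

/-- A reflexive graph `(C₁, C₀, d, c, e)`. -/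
structure ReflexiveGraph (C₁ C₀ : C) where
  d : C₁ ⟶ C₀
  c : C₁ ⟶ C₀
  e : C₀ ⟶ C₁
  e_d : e ≫ d = 𝟙 C₀
  e_c : e ≫ c = 𝟙 C₀

/-- An *internal groupoid structure* on a reflexive graph. The composition `m` is defined on the
object of pairs `(f, g)` with `d f = c g`, and `m (f, g)` is `g` followed by `f`. The laws are
stated for generalised elements. -/
structure GroupoidStructure {C₁ C₀ : C} (G : ReflexiveGraph C₁ C₀) where
  m : pullback G.d G.c ⟶ C₁
  m_d : m ≫ G.d = pullback.snd G.d G.c ≫ G.d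
  m_c : m ≫ G.c = pullback.fst G.d G.c ≫ G.c
  m_one : pullback.lift (𝟙 C₁) (G.d ≫ G.e) (by simp [G.e_c]) ≫ m = 𝟙 C₁
  one_m : pullback.lift (G.c ≫ G.e) (𝟙 C₁) (by simp [G.e_d]) ≫ m = 𝟙 C₁
  assoc {T : C} (f g h : T ⟶ C₁) (hfg : f ≫ G.d = g ≫ G.c) (hgh : g ≫ G.d = h ≫ G.c) :
    pullback.lift (pullback.lift f g hfg ≫ m) h (by simp [m_d, hgh]) ≫ m =
      pullback.lift f (pullback.lift g h hgh ≫ m) (by simp [m_c, hfg]) ≫ m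
  inv : C₁ ⟶ C₁
  inv_d : inv ≫ G.d = G.c
  inv_c : inv ≫ G.c = G.d
  m_inv : pullback.lift (𝟙 C₁) inv (by simp [inv_c]) ≫ m = G.c ≫ G.e
  inv_m : pullback.lift inv (𝟙 C₁) (by simp [inv_d]) ≫ m = G.d ≫ G.e

/-- `(δ, ξ)` is an *internal crossed module*: there is `c : X ⋊ B ⟶ B` with `c ∘ e = 1` and
`c ∘ k = δ` (that is, `(δ, ξ)` is an internal precrossed module) such that the reflexive graph
`(X ⋊ B, B, d, c, e)` admits an internal groupoid structure. -/
def IsInternalCrossedModule {X B : C} (δ : X ⟶ B) (ξ : Action B X) : Prop :=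
  ∃ (c : ξ.semidirect ⟶ B) (hc : ξ.e ≫ c = 𝟙 B), ξ.k ≫ c = δ ∧
    Nonempty (GroupoidStructure
      { d := ξ.d, c := c, e := ξ.e, e_d := ξ.e_d, e_c := hc : ReflexiveGraph ξ.semidirect B })

/-! ### The Smith-is-Huq condition -/

/-- Two arrows with the same codomain *(Huq-)commute* when they have a cooperator. -/
def HuqCommute {X B Y : C} (f : X ⟶ Y) (g : B ⟶ Y) : Prop :=
  ∃ φ : X ⨯ B ⟶ Y, prod.lift (𝟙 X) 0 ≫ φ = f ∧ prod.lift 0 (𝟙 B) ≫ φ = g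

/-- Two equivalence relations `R`, `S` on `X` *commute* (in the sense of Smith) when there is a
connector between them: an arrow `θ` on the object of triples `x R y S z` with `θ (x, y, y) = x`
and `θ (y, y, z) = z`. -/
def SmithCommute {X R S : C} {r₁ r₂ : R ⟶ X} {s₁ s₂ : S ⟶ X}
    (hR : EquivalenceRelation r₁ r₂) (hS : EquivalenceRelation s₁ s₂) : Prop :=
  ∃ θ : pullback r₂ s₁ ⟶ X,
    pullback.lift (𝟙 R) (r₂ ≫ hS.r) (by simp) ≫ θ = r₁ ∧
    pullback.lift (s₁ ≫ hR.r) (𝟙 S) (by simp) ≫ θ = s₂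

/-- The normalisation `c ∘ ker d` of a pair `d, c`. -/
def normalisation {R X : C} (d c : R ⟶ X) : kernel d ⟶ X := kernel.ι d ≫ c

variable (C) in
/-- The *Smith-is-Huq condition* (SH): two effective equivalence relations commute if and only if
their normalisations commute. -/
def SmithIsHuq : Prop :=
  ∀ {X R S : C} {r₁ r₂ : R ⟶ X} {s₁ s₂ : S ⟶ X}
    (hR : EffectiveEquivalenceRelation r₁ r₂) (hS : EffectiveEquivalenceRelation s₁ s₂),
    SmithCommute hR.toEquivalenceRelation hS.toEquivalenceRelation ↔
      HuqCommute (normalisation r₁ r₂) (normalisation s₁ s₂)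

end

end SemiAbelian

namespace SemiAbelian

attribute [local simp] prod.lift_fst prod.lift_fst_assoc prod.lift_snd prod.lift_snd_assoc
  pullback.lift_fst pullback.lift_fst_assoc pullback.lift_snd pullback.lift_snd_assoc
  coprod.inl_desc coprod.inl_desc_assoc coprod.inr_desc coprod.inr_desc_assoc
  coprod.inl_map coprod.inl_map_assoc coprod.inr_map coprod.inr_map_assoc
  coequalizer.π_desc coequalizer.π_desc_assoc kernel.lift_ι kernel.lift_ι_assoc

variable {C : Type u} [Category.{v} C] [HasZeroMorphisms C] [SemiAbelian C]

/-! ### Protomodularity: jointly epic pairs and normal epimorphisms -/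

/-! The arrow `[k, e]` is a regular epimorphism, hence a cokernel of its kernel. So a twisted
commutator vanishes exactly when the two arrows extend along `k` and `e`
(`relCommutator_eq_bot_iff`). For `[δ, 1]` the extension is the second leg `c` of a reflexive graph.
For conjugation the semi-direct product is `X × X`, with `k = (0, 1)` and `e = (1, 1)`, so the other
condition asks for `φ : X × X ⟶ X ⋊ B` with `φ(0, z) = k z` and `φ(x, x) = e (δ x)`.

Read `k x` as an arrow `0 → δ x` of the graph. In a groupoid, `φ(x, z) = k z ∘ (k x)⁻¹` has the
required values. Conversely, `φ` is by definition a cooperator of `φ(-, 0)` and `k`. Every arrow in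
the kernel of `c` is locally of the form `φ(y, 0)`, so the kernels of `d` and `c` commute
(`Action.huqCommute_of_peiffer`). By (SH) the kernel pairs of `d` and `c` then have a connector, and
`GroupoidStructure.ofConnector` turns it into a groupoid.

Two facts are used throughout. By protomodularity, identities can be checked on a kernel together
with a section. By associativity of the action, `k` really is the kernel of `d`
(`Action.nonempty_isLimit_k`). -/

/-- The kernel and the section of a split epimorphism are jointly epic. -/
lemma hom_ext_of_kernel_section {K A B Z : C} {k : K ⟶ A} {p : A ⟶ B} {s : B ⟶ A}
    (w : k ≫ p = 0) (hk : IsLimit (KernelFork.ofι k w)) (hs : s ≫ p = 𝟙 B) {f g : A ⟶ Z}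
    (hkfg : k ≫ f = k ≫ g) (hsfg : s ≫ f = s ≫ g) : f = g := by
  let ι := equalizer.ι f g
  let k' : K ⟶ equalizer f g := equalizer.lift k hkfg
  have hk' : k' ≫ ι = k := equalizer.lift_ι _ _
  let s' : B ⟶ equalizer f g := equalizer.lift s hsfg
  have hs' : s' ≫ ι = s := equalizer.lift_ι _ _
  have w' : k' ≫ ι ≫ p = 0 := by rw [reassoc_of% hk', w]
  have hk'' : IsLimit (KernelFork.ofι k' w') :=
    KernelFork.IsLimit.ofι _ _
      (fun z hz => hk.lift (KernelFork.ofι (z ≫ ι) (by simpa using hz)))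
      (fun z hz => by
        rw [← cancel_mono ι, Category.assoc, hk']
        exact hk.fac (KernelFork.ofι (z ≫ ι) (by simpa using hz)) WalkingParallelPair.zero)
      (fun z hz l hl => by
        apply Fork.IsLimit.hom_ext hk
        have h := hk.fac (KernelFork.ofι (z ≫ ι) (by simpa using hz)) WalkingParallelPair.zero
        refine Eq.trans ?_ h.symm
        change l ≫ k = z ≫ ι
        rw [← hl, Category.assoc, hk'])
  -- The equaliser contains both `k` and `s`, so it is a split extension with the same ends as `A`.
  have : IsIso ι := splitShortFive (s := s') (s' := s) (x := 𝟙 K) (b := 𝟙 B) w' ⟨hk''⟩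
    (by rw [reassoc_of% hs', hs]) w ⟨hk⟩ hs (by simp [hk']) (by simp) (by simp [hs'])
    inferInstance inferInstance
  rw [← cancel_epi ι]
  exact equalizer.condition f g

/-- The two canonical inclusions into a pullback of split epimorphisms are jointly epic. -/
lemma pullback_hom_ext_of_sections {A B D Z : C} {p : A ⟶ B} {s : B ⟶ A} {q : D ⟶ B} {t : B ⟶ D}
    (hs : s ≫ p = 𝟙 B) (ht : t ≫ q = 𝟙 B) {f g : pullback p q ⟶ Z}
    (hl : pullback.lift (𝟙 A) (p ≫ t) (by simp [ht]) ≫ f =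
      pullback.lift (𝟙 A) (p ≫ t) (by simp [ht]) ≫ g)
    (hr : pullback.lift (q ≫ s) (𝟙 D) (by simp [hs]) ≫ f =
      pullback.lift (q ≫ s) (𝟙 D) (by simp [hs]) ≫ g) : f = g := by
  have := isIso_of_mono_pullback hs ht (equalizer.ι f g) (equalizer.lift _ hl)
    (equalizer.lift_ι _ _) (equalizer.lift _ hr) (equalizer.lift_ι _ _)
  rw [← cancel_epi (equalizer.ι f g)]
  exact equalizer.condition f g

/-- `(0, 1)` is the kernel of the first projection of a product. -/
noncomputable def isLimitKernelProdFst (X Y : C) :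
    IsLimit (KernelFork.ofι (prod.lift 0 (𝟙 Y) : Y ⟶ X ⨯ Y)
      (show prod.lift 0 (𝟙 Y) ≫ prod.fst = 0 by simp)) :=
  KernelFork.IsLimit.ofι _ _ (fun z _ => z ≫ prod.snd)
    (fun z hz => by apply Limits.prod.hom_ext <;> simp [hz]) (fun z hz l hl => by simp [← hl])

/-- The diagonal and the second inclusion of `X × X` are jointly epic. -/
lemma prod_hom_ext_of_diag {X Z : C} {f g : X ⨯ X ⟶ Z}
    (hr : prod.lift 0 (𝟙 X) ≫ f = prod.lift 0 (𝟙 X) ≫ g)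
    (hd : prod.lift (𝟙 X) (𝟙 X) ≫ f = prod.lift (𝟙 X) (𝟙 X) ≫ g) : f = g :=
  hom_ext_of_kernel_section _ (isLimitKernelProdFst X X) (prod.lift_fst _ _) hr hd

/-- The two canonical inclusions into a product are jointly epic. -/
lemma prod_hom_ext_of_inclusions {X Y Z : C} {f g : X ⨯ Y ⟶ Z}
    (hl : prod.lift (𝟙 X) 0 ≫ f = prod.lift (𝟙 X) 0 ≫ g)
    (hr : prod.lift 0 (𝟙 Y) ≫ f = prod.lift 0 (𝟙 Y) ≫ g) : f = g :=
  hom_ext_of_kernel_section _ (isLimitKernelProdFst X Y) (prod.lift_fst _ _) hr hl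

/-- Every regular epimorphism is a cokernel of its kernel: morphisms vanishing on the kernel
descend. -/
lemma exists_desc_of_kernel_comp {A Q Z : C} (p : A ⟶ Q) [IsRegularEpi p] (f : A ⟶ Z)
    (hf : kernel.ι p ≫ f = 0) : ∃ g : Q ⟶ Z, p ≫ g = f := by
  let Δ : A ⟶ pullback p p := pullback.lift (𝟙 A) (𝟙 A) rfl
  -- It suffices to test on the diagonal and on the kernel of the first projection; the latter is
  -- carried into the kernel of `p` by the second projection.
  have key : pullback.fst p p ≫ f = pullback.snd p p ≫ f := by
    refine hom_ext_of_kernel_section (s := Δ) (kernel.condition _) (kernelIsKernel (pullback.fst p p))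
      (pullback.lift_fst _ _ _) ?_ (by simp [Δ])
    have h : kernel.ι (pullback.fst p p) ≫ pullback.snd p p =
        kernel.lift p (kernel.ι (pullback.fst p p) ≫ pullback.snd p p)
          (by rw [Category.assoc, ← pullback.condition, kernel.condition_assoc, zero_comp]) ≫
          kernel.ι p := by simp
    rw [kernel.condition_assoc, zero_comp, ← Category.assoc, h, Category.assoc, hf, comp_zero]
  refine ⟨IsRegularEpi.desc p f ?_, IsRegularEpi.fac p f _⟩
  have h := pullback.lift (IsRegularEpi.left p) (IsRegularEpi.right p) (IsRegularEpi.w p) ≫= key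
  simpa using h

/-- The image of a morphism is zero exactly when the morphism is. -/
lemma imageSubobject_eq_bot_iff {A Y : C} (f : A ⟶ Y) : imageSubobject f = ⊥ ↔ f = 0 := by
  constructor
  · intro h
    have h' : (imageSubobject f).Factors f := by
      simpa using imageSubobject_factors_comp_self f (𝟙 A)
    rw [h, Subobject.bot_factors_iff_zero] at h'
    exact h'
  · rintro rfl
    exact imageSubobject_zero

/-- If `[k, s]` is a regular epimorphism, the `(k, s)`-commutator of `f` and `g` vanishes exactly
when `f` and `g` extend along `k` and `s`. -/
lemma relCommutator_eq_bot_iff {X A B Y : C} (k : X ⟶ A) (s : B ⟶ A)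
    [IsRegularEpi (coprod.desc k s)] (f : X ⟶ Y) (g : B ⟶ Y) :
    relCommutator k s f g = ⊥ ↔ ∃ φ : A ⟶ Y, k ≫ φ = f ∧ s ≫ φ = g := by
  rw [relCommutator, imageSubobject_eq_bot_iff]
  constructor
  · intro h
    obtain ⟨φ, hφ⟩ := exists_desc_of_kernel_comp _ _ h
    exact ⟨φ, by simpa using coprod.inl ≫= hφ, by simpa using coprod.inr ≫= hφ⟩
  · rintro ⟨φ, rfl, rfl⟩
    have : coprod.desc (k ≫ φ) (s ≫ φ) = coprod.desc k s ≫ φ := by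
      apply coprod.hom_ext <;> simp
    rw [this, kernel.condition_assoc, zero_comp]

/-- The image of a reflexive graph in the square of its object of objects is an equivalence
relation. -/
lemma exists_image_equivalenceRelation {W Y : C} (u v : W ⟶ Y) (s : Y ⟶ W) (hu : s ≫ u = 𝟙 Y)
    (hv : s ≫ v = 𝟙 Y) : ∃ (R : C) (p : W ⟶ R) (d c : R ⟶ Y),
      IsRegularEpi p ∧ p ≫ d = u ∧ p ≫ c = v ∧ IsEquivalenceRelation d c := by
  let F := Regular.strongEpiMonoFactorisation (prod.lift u v)
  have hd : F.e ≫ F.m ≫ prod.fst = u := by rw [← Category.assoc, F.fac, prod.lift_fst]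
  have hc : F.e ≫ F.m ≫ prod.snd = v := by rw [← Category.assoc, F.fac, prod.lift_snd]
  refine ⟨F.I, F.e, F.m ≫ prod.fst, F.m ≫ prod.snd,
    inferInstanceAs (IsRegularEpi (Regular.strongEpiMonoFactorisation _).e), hd, hc,
    isEquivalenceRelation_of_reflexive
      { right_cancellation := fun Z a b h₁ h₂ => by
          rw [← cancel_mono F.m]
          apply Limits.prod.hom_ext
          · simpa using h₁
          · simpa using h₂
        r := s ≫ F.e
        reflexivity₁ := by rw [Category.assoc, hd, hu]
        reflexivity₂ := by rw [Category.assoc, hc, hv] }⟩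

/-! ### The split extension induced by an action -/

namespace Action

variable {B X : C} (ξ : Action B X)

lemma flatι_q : flatι B X ≫ ξ.q = ξ.act ≫ ξ.k :=
  (coequalizer.condition _ _).trans (Category.assoc _ _ _)

lemma exists_desc {Z : C} (f : B ⨿ X ⟶ Z) (h : flatι B X ≫ f = ξ.act ≫ coprod.inr ≫ f) :
    ∃ g : ξ.semidirect ⟶ Z, ξ.q ≫ g = f :=
  ⟨coequalizer.desc f (by simpa using h), coequalizer.π_desc _ _⟩

lemma k_d : ξ.k ≫ ξ.d = 0 := by rw [k, Category.assoc, q_d, coprod.inr_desc]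

instance : IsRegularEpi ξ.q := inferInstanceAs (IsRegularEpi (coequalizer.π _ _))

/-- The kernel pair of the quotient `q` is the image of the pair `[ι₁, κ]`, `1 + ξ`. -/
lemma exists_cover_of_comp_q_eq {T : C} (a b : T ⟶ B ⨿ X) (h : a ≫ ξ.q = b ≫ ξ.q) :
    ∃ (T' : C) (p : T' ⟶ T) (_ : IsRegularEpi p) (w : T' ⟶ B ⨿ flat B X),
      w ≫ coprod.desc coprod.inl (flatι B X) = p ≫ a ∧
        w ≫ coprod.map (𝟙 B) ξ.act = p ≫ b := by
  -- The unit law makes `u`, `v` a reflexive pair, so its image is an equivalence relation, hence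
  -- effective. Its quotient map factors through `q`, so elements identified by `q` are related in
  -- the image and lift along a cover.
  let u : B ⨿ flat B X ⟶ B ⨿ X := coprod.desc coprod.inl (flatι B X)
  let v : B ⨿ flat B X ⟶ B ⨿ X := coprod.map (𝟙 B) ξ.act
  obtain ⟨R, p, d, c, hp, hd, hc, hR⟩ := exists_image_equivalenceRelation u v
    (coprod.map (𝟙 B) (flatUnit B X))
    (by apply coprod.hom_ext <;> simp [u, flatUnit_ι])
    (by apply coprod.hom_ext <;> simp [v, reassoc_of% ξ.unit])
  obtain ⟨⟨E⟩⟩ := isEffective d c hR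
  have hdc : u ≫ E.π = v ≫ E.π := by rw [← hd, ← hc, Category.assoc, Category.assoc, E.isPushout.w]
  obtain ⟨π', hq⟩ := ξ.exists_desc E.π (by simpa [u, v] using coprod.inr ≫= hdc)
  have hπ : a ≫ E.π = b ≫ E.π := by rw [← hq, reassoc_of% h]
  let ρ : T ⟶ R := E.isKernelPair.lift a b hπ
  have hρd : ρ ≫ d = a := E.isKernelPair.lift_fst _ _ _
  have hρc : ρ ≫ c = b := E.isKernelPair.lift_snd _ _ _
  refine ⟨pullback ρ p, pullback.fst _ _, inferInstance, pullback.snd _ _, ?_, ?_⟩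
  · change _ ≫ u = _
    rw [← hd, ← pullback.condition_assoc, hρd]
  · change _ ≫ v = _
    rw [← hc, ← pullback.condition_assoc, hρc]

/-- The action is determined by its quotient map. -/
lemma act_eq_of_comp_q_eq {T : C} (a b : T ⟶ flat B X)
    (h : a ≫ flatι B X ≫ ξ.q = b ≫ flatι B X ≫ ξ.q) : a ≫ ξ.act = b ≫ ξ.act := by
  obtain ⟨T', p, hp, w, hwa, hwb⟩ :=
    ξ.exists_cover_of_comp_q_eq (a ≫ flatι B X) (b ≫ flatι B X) (by simpa using h)
  have hw : w ≫ coprod.desc (𝟙 B) 0 = 0 := by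
    have h₁ : coprod.desc coprod.inl (flatι B X) ≫ coprod.desc (𝟙 B) 0 =
        coprod.desc (𝟙 B) (0 : flat B X ⟶ B) := by
      apply coprod.hom_ext <;> simp
    rw [← h₁, reassoc_of% hwa, kernel.condition, comp_zero, comp_zero]
  -- On `B ♭ (B ♭ X)` the covering pair restricts to `μ` and `1 ♭ ξ`, which `ξ` equalises by
  -- associativity.
  let w' : T' ⟶ flat B (flat B X) := kernel.lift _ w hw
  have hw' : w' ≫ flatι B (flat B X) = w := kernel.lift_ι _ _ _
  have h₁ : w' ≫ flatMul B X = p ≫ a := by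
    rw [← cancel_mono (flatι B X), Category.assoc, Category.assoc, flatMul_ι, reassoc_of% hw', hwa]
  have h₂ : w' ≫ flatMap (𝟙 B) ξ.act = p ≫ b := by
    rw [← cancel_mono (flatι B X), Category.assoc, Category.assoc, flatMap_ι, reassoc_of% hw', hwb]
  rw [← cancel_epi p, ← reassoc_of% h₁, ξ.assoc, reassoc_of% h₂]

/-- The unit law recovers `a` from `ξ ∘ η ∘ a`, and `ξ` depends only on classes modulo `q`. -/
instance : Mono ξ.k where
  right_cancellation a b h := by
    have := ξ.act_eq_of_comp_q_eq (a ≫ flatUnit B X) (b ≫ flatUnit B X)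
      (by simpa [flatι_q, reassoc_of% ξ.unit] using h)
    simpa [ξ.unit] using this

/-- The arrow `k` is the kernel of `d`. -/
lemma nonempty_isLimit_k : Nonempty (IsLimit (KernelFork.ofι ξ.k ξ.k_d)) := by
  let p₁ := pullback.fst ξ.q (kernel.ι ξ.d)
  let p₂ := pullback.snd ξ.q (kernel.ι ξ.d)
  have hp : p₁ ≫ ξ.q = p₂ ≫ kernel.ι ξ.d := pullback.condition
  -- An element of the kernel of `d` lifts locally along `q`, and the lift lies in `B ♭ X`. Applying
  -- `ξ` gives a local preimage under `k`, which descends because it depends only on the class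
  -- modulo `q`.
  let t : pullback ξ.q (kernel.ι ξ.d) ⟶ flat B X :=
    kernel.lift _ p₁ (by rw [← q_d, reassoc_of% hp, kernel.condition, comp_zero])
  have ht : t ≫ flatι B X = p₁ := kernel.lift_ι _ _ _
  obtain ⟨r, hr⟩ := exists_desc_of_kernel_comp p₂ (t ≫ ξ.act) (by
    have := ξ.act_eq_of_comp_q_eq (kernel.ι p₂ ≫ t) 0 (by
      rw [Category.assoc, reassoc_of% ht, hp, kernel.condition_assoc, zero_comp, zero_comp])
    simpa using this)
  have hrk : r ≫ ξ.k = kernel.ι ξ.d := by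
    rw [← cancel_epi p₂, reassoc_of% hr, ← flatι_q, reassoc_of% ht, hp]
  exact ⟨KernelFork.IsLimit.ofι' _ _ fun {T} z hz =>
    ⟨kernel.lift ξ.d z hz ≫ r, by rw [Category.assoc, hrk, kernel.lift_ι]⟩⟩

lemma exists_lift_k {T : C} (z : T ⟶ ξ.semidirect) (hz : z ≫ ξ.d = 0) :
    ∃ l : T ⟶ X, l ≫ ξ.k = z := by
  obtain ⟨h⟩ := ξ.nonempty_isLimit_k
  exact ⟨h.lift (KernelFork.ofι z hz), h.fac _ WalkingParallelPair.zero⟩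

lemma hom_ext {Z : C} {f g : ξ.semidirect ⟶ Z} (hk : ξ.k ≫ f = ξ.k ≫ g)
    (he : ξ.e ≫ f = ξ.e ≫ g) : f = g := by
  rw [← cancel_epi ξ.q]
  apply coprod.hom_ext
  · simpa [e] using he
  · simpa [k] using hk

/-- This is `q` up to exchanging the summands; it makes the extension criterion for commutators
applicable. -/
instance : IsRegularEpi (coprod.desc ξ.k ξ.e) := by
  have : coprod.desc ξ.k ξ.e = (coprod.braiding X B).hom ≫ ξ.q := by
    apply coprod.hom_ext <;> simp [k, e]
  have : StrongEpi (coprod.desc ξ.k ξ.e) := this ▸ strongEpi_comp _ _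
  infer_instance

/-- A twisted commutator vanishes exactly when the two arrows extend to the semi-direct product. -/
lemma commutator_eq_bot_iff {Y : C} (f : X ⟶ Y) (g : B ⟶ Y) :
    ξ.commutator f g = ⊥ ↔ ∃ φ : ξ.semidirect ⟶ Y, ξ.k ≫ φ = f ∧ ξ.e ≫ φ = g :=
  relCommutator_eq_bot_iff _ _ _ _

end Action

/-- The semi-direct product of the conjugation action of `X` is the product `X × X`. -/
lemma commutator_conjAction_eq_bot_iff {X Y : C} (f g : X ⟶ Y) :
    (conjAction X).commutator f g = ⊥ ↔
      ∃ φ : X ⨯ X ⟶ Y, prod.lift 0 (𝟙 X) ≫ φ = f ∧ prod.lift (𝟙 X) (𝟙 X) ≫ φ = g := by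
  rw [Action.commutator_eq_bot_iff]
  obtain ⟨h, hq⟩ := (conjAction X).exists_desc
    (coprod.desc (prod.lift (𝟙 X) (𝟙 X)) (prod.lift 0 (𝟙 X))) (by
      apply Limits.prod.hom_ext
      · have : coprod.desc (prod.lift (𝟙 X) (𝟙 X)) (prod.lift 0 (𝟙 X)) ≫ prod.fst =
            coprod.desc (𝟙 X) (0 : X ⟶ X) := by apply coprod.hom_ext <;> simp
        simp [this]
      · have : coprod.desc (prod.lift (𝟙 X) (𝟙 X)) (prod.lift 0 (𝟙 X)) ≫ prod.snd =
            coprod.desc (𝟙 X) (𝟙 X) := by apply coprod.hom_ext <;> simp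
        simp [this, conjAction])
  have hk : (conjAction X).k ≫ h = prod.lift 0 (𝟙 X) := by
    rw [Action.k, Category.assoc, hq, coprod.inr_desc]
  have he : (conjAction X).e ≫ h = prod.lift (𝟙 X) (𝟙 X) := by
    rw [Action.e, Category.assoc, hq, coprod.inl_desc]
  have hd : h ≫ prod.fst = (conjAction X).d := by
    apply Action.hom_ext
    · rw [reassoc_of% hk, Action.k_d, prod.lift_fst]
    · rw [reassoc_of% he, Action.e_d, prod.lift_fst]
  -- Both sides are split extensions of `X` by `X`: the second is the first projection with the
  -- diagonal as section.
  have : IsIso h := splitShortFive (x := 𝟙 X) (b := 𝟙 X) (conjAction X).k_d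
    (conjAction X).nonempty_isLimit_k (conjAction X).e_d _ ⟨isLimitKernelProdFst X X⟩
    (prod.lift_fst (𝟙 X) (𝟙 X)) (by simp [hk]) (by simp [hd]) (by simp [he])
    inferInstance inferInstance
  constructor
  · rintro ⟨φ, rfl, rfl⟩
    exact ⟨inv h ≫ φ, by simp [← hk], by simp [← he]⟩
  · rintro ⟨φ, rfl, rfl⟩
    exact ⟨h ≫ φ, by rw [reassoc_of% hk], by rw [reassoc_of% he]⟩

/-! ### Groupoids from connectors -/

section Connector

variable {A B T : C} {d c : A ⟶ B}

/-- The value of a connector between the kernel pairs of `d` and `c` at generalised elements. -/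
noncomputable def connectorApp (θ : pullback (pullback.snd d d) (pullback.fst c c) ⟶ A)
    (x y z : T ⟶ A) (hxy : x ≫ d = y ≫ d) (hyz : y ≫ c = z ≫ c) : T ⟶ A :=
  pullback.lift (pullback.lift x y hxy) (pullback.lift y z hyz) (by simp) ≫ θ

variable {θ : pullback (pullback.snd d d) (pullback.fst c c) ⟶ A}

lemma comp_connectorApp {T' : C} (t : T' ⟶ T) (x y z : T ⟶ A) (hxy : x ≫ d = y ≫ d)
    (hyz : y ≫ c = z ≫ c) : t ≫ connectorApp θ x y z hxy hyz =
      connectorApp θ (t ≫ x) (t ≫ y) (t ≫ z) (by simp [hxy]) (by simp [hyz]) := by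
  rw [connectorApp, connectorApp, ← Category.assoc]
  congr 1
  apply pullback.hom_ext <;> apply pullback.hom_ext <;> simp

/-- Natural identities between triples `x R y S z` may be checked on the triples `(x, y, y)` and
`(y, y, z)`. -/
lemma connector_hom_ext {Z : C} {f g : pullback (pullback.snd d d) (pullback.fst c c) ⟶ Z}
    (hl : ∀ {T : C} (x y : T ⟶ A) (h : x ≫ d = y ≫ d),
      pullback.lift (pullback.lift x y h) (pullback.lift y y rfl) (by simp) ≫ f =
        pullback.lift (pullback.lift x y h) (pullback.lift y y rfl) (by simp) ≫ g)
    (hr : ∀ {T : C} (y z : T ⟶ A) (h : y ≫ c = z ≫ c),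
      pullback.lift (pullback.lift y y rfl) (pullback.lift y z h) (by simp) ≫ f =
        pullback.lift (pullback.lift y y rfl) (pullback.lift y z h) (by simp) ≫ g) : f = g := by
  refine pullback_hom_ext_of_sections (s := pullback.lift (𝟙 A) (𝟙 A) rfl)
    (t := pullback.lift (𝟙 A) (𝟙 A) rfl) (pullback.lift_snd _ _ _) (pullback.lift_fst _ _ _) ?_ ?_
  · convert hl (pullback.fst d d) (pullback.snd d d) pullback.condition using 2 <;>
    · apply pullback.hom_ext <;> apply pullback.hom_ext <;> simp
  · convert hr (pullback.fst c c) (pullback.snd c c) pullback.condition using 2 <;>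
    · apply pullback.hom_ext <;> apply pullback.hom_ext <;> simp

/-- A connector between the kernel pairs of `d` and `c`. -/
structure IsConnector (θ : pullback (pullback.snd d d) (pullback.fst c c) ⟶ A) : Prop where
  left {T : C} (x y : T ⟶ A) (h : x ≫ d = y ≫ d) : connectorApp θ x y y h rfl = x
  right {T : C} (y z : T ⟶ A) (h : y ≫ c = z ≫ c) : connectorApp θ y y z rfl h = z

lemma SmithCommute.exists_isConnector
    {hR : EquivalenceRelation (pullback.fst d d) (pullback.snd d d)}
    {hS : EquivalenceRelation (pullback.fst c c) (pullback.snd c c)} (h : SmithCommute hR hS) :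
    ∃ θ : pullback (pullback.snd d d) (pullback.fst c c) ⟶ A, IsConnector θ := by
  obtain ⟨θ, h₁, h₂⟩ := h
  refine ⟨θ, fun x y h => ?_, fun y z h => ?_⟩
  · have := pullback.lift x y h ≫= h₁
    rw [pullback.lift_fst, ← Category.assoc] at this
    refine Eq.trans (congrArg (· ≫ θ) ?_) this
    apply pullback.hom_ext <;> apply pullback.hom_ext <;> simp
  · have := pullback.lift y z h ≫= h₂
    rw [pullback.lift_snd, ← Category.assoc] at this
    refine Eq.trans (congrArg (· ≫ θ) ?_) this
    apply pullback.hom_ext <;> apply pullback.hom_ext <;> simp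

namespace IsConnector

/-- Compatibility of `θ` with `d` and `c` need not be assumed: it holds on the triples `(x, y, y)`
and `(y, y, z)`, which are jointly epic. -/
lemma app_fst (hθ : IsConnector θ) (x y z : T ⟶ A) (hxy : x ≫ d = y ≫ d) (hyz : y ≫ c = z ≫ c) :
    connectorApp θ x y z hxy hyz ≫ d = z ≫ d := by
  have : θ ≫ d = pullback.snd _ _ ≫ pullback.snd _ _ ≫ d := by
    apply connector_hom_ext
    · intro T x y h
      rw [← Category.assoc]
      refine (congrArg (· ≫ d) (hθ.left x y h)).trans ?_
      simp [h]
    · intro T y z h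
      rw [← Category.assoc]
      refine (congrArg (· ≫ d) (hθ.right y z h)).trans ?_
      simp
  rw [connectorApp, Category.assoc, this]
  simp

lemma app_snd (hθ : IsConnector θ) (x y z : T ⟶ A) (hxy : x ≫ d = y ≫ d) (hyz : y ≫ c = z ≫ c) :
    connectorApp θ x y z hxy hyz ≫ c = x ≫ c := by
  have : θ ≫ c = pullback.fst _ _ ≫ pullback.fst _ _ ≫ c := by
    apply connector_hom_ext
    · intro T x y h
      rw [← Category.assoc]
      refine (congrArg (· ≫ c) (hθ.left x y h)).trans ?_
      simp
    · intro T y z h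
      rw [← Category.assoc]
      refine (congrArg (· ≫ c) (hθ.right y z h)).trans ?_
      simp [h]
  rw [connectorApp, Category.assoc, this]
  simp

/-- In groups this reads `x y⁻¹ (y x⁻¹ z) = z`. Together with its mirror image it yields the inverse
laws of the groupoid. -/
lemma app_app_right (hθ : IsConnector θ) (x y z : T ⟶ A) (hxy : x ≫ d = y ≫ d)
    (hxz : x ≫ c = z ≫ c) :
    connectorApp θ x y (connectorApp θ y x z hxy.symm hxz) hxy (by rw [hθ.app_snd]) = z := by
  let y₀ := pullback.fst (pullback.snd d d) (pullback.fst c c) ≫ pullback.fst d d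
  let x₀ := pullback.fst (pullback.snd d d) (pullback.fst c c) ≫ pullback.snd d d
  let z₀ := pullback.snd (pullback.snd d d) (pullback.fst c c) ≫ pullback.snd c c
  have h₁ : x₀ ≫ d = y₀ ≫ d := by
    rw [Category.assoc, Category.assoc, pullback.condition (f := d)]
  have h₂ : x₀ ≫ c = z₀ ≫ c := by
    simp only [x₀, z₀, Category.assoc, pullback.condition]
  have : connectorApp θ x₀ y₀ (connectorApp θ y₀ x₀ z₀ h₁.symm h₂) h₁ (by rw [hθ.app_snd]) =
      z₀ := by
    apply connector_hom_ext
    · intro T x y h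
      simp [comp_connectorApp, x₀, y₀, z₀, hθ.left]
    · intro T y z h
      simp [comp_connectorApp, x₀, y₀, z₀, hθ.right]
  have := pullback.lift (pullback.lift y x hxy.symm) (pullback.lift x z hxz) (by simp) ≫= this
  simpa [comp_connectorApp, x₀, y₀, z₀] using this

lemma app_app_left (hθ : IsConnector θ) (x y z : T ⟶ A) (hxy : x ≫ d = y ≫ d)
    (hyz : y ≫ c = z ≫ c) :
    connectorApp θ (connectorApp θ x y z hxy hyz) z y (by rw [hθ.app_fst]) hyz.symm = x := by
  let x₀ := pullback.fst (pullback.snd d d) (pullback.fst c c) ≫ pullback.fst d d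
  let y₀ := pullback.fst (pullback.snd d d) (pullback.fst c c) ≫ pullback.snd d d
  let z₀ := pullback.snd (pullback.snd d d) (pullback.fst c c) ≫ pullback.snd c c
  have h₁ : x₀ ≫ d = y₀ ≫ d := by
    rw [Category.assoc, Category.assoc, pullback.condition (f := d)]
  have h₂ : y₀ ≫ c = z₀ ≫ c := by
    simp only [y₀, z₀, Category.assoc, pullback.condition]
  have : connectorApp θ (connectorApp θ x₀ y₀ z₀ h₁ h₂) z₀ y₀ (by rw [hθ.app_fst]) h₂.symm =
      x₀ := by
    apply connector_hom_ext
    · intro T x y h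
      simp [comp_connectorApp, x₀, y₀, z₀, hθ.left]
    · intro T y z h
      simp [comp_connectorApp, x₀, y₀, z₀, hθ.right]
  have := pullback.lift (pullback.lift x y hxy) (pullback.lift y z hyz) (by simp) ≫= this
  simpa [comp_connectorApp, x₀, y₀, z₀] using this

end IsConnector

end Connector

/-- A connector between the kernel pairs of the two legs of a reflexive graph makes the graph an
internal groupoid. -/
noncomputable def GroupoidStructure.ofConnector {C₁ C₀ : C} (G : ReflexiveGraph C₁ C₀)
    {θ : pullback (pullback.snd G.d G.d) (pullback.fst G.c G.c) ⟶ C₁} (hθ : IsConnector θ) :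
    GroupoidStructure G :=
  have hd {T : C} (f : T ⟶ C₁) : f ≫ G.d = (f ≫ G.d ≫ G.e) ≫ G.d := by simp [G.e_d]
  have hc {T : C} (f g : T ⟶ C₁) (h : f ≫ G.d = g ≫ G.c) : (f ≫ G.d ≫ G.e) ≫ G.c = g ≫ G.c := by
    simp [G.e_c, h]
  -- The composite of `f` and `g` is `θ(f, 1, g)`, with the identity taken at the object where they
  -- meet.
  let m : pullback G.d G.c ⟶ C₁ :=
    connectorApp θ (pullback.fst _ _) (pullback.fst _ _ ≫ G.d ≫ G.e) (pullback.snd _ _)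
      (hd _) (hc _ _ pullback.condition)
  have hm {T : C} (f g : T ⟶ C₁) (h : f ≫ G.d = g ≫ G.c) : pullback.lift f g h ≫ m =
      connectorApp θ f (f ≫ G.d ≫ G.e) g (hd f) (hc f g h) := by
    simp [m, comp_connectorApp]
  have hm₁ {T : C} (f g : T ⟶ C₁) (h : f ≫ G.d = g ≫ G.c) (hg : g = f ≫ G.d ≫ G.e) :
      pullback.lift f g h ≫ m = f := by
    subst hg
    rw [hm, hθ.left]
  have h₁m {T : C} (f g : T ⟶ C₁) (h : f ≫ G.d = g ≫ G.c) (hf : f = g ≫ G.c ≫ G.e) :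
      pullback.lift f g h ≫ m = g := by
    subst hf
    rw [hm]
    simp [reassoc_of% G.e_d, hθ.right]
  have hcomp {T T' : C} (t : T' ⟶ T) (f g : T ⟶ C₁) (h : f ≫ G.d = g ≫ G.c) :
      t ≫ pullback.lift f g h ≫ m =
        pullback.lift (t ≫ f) (t ≫ g) (by rw [Category.assoc, h, Category.assoc]) ≫ m := by
    rw [hm, hm, comp_connectorApp]
    simp
  have m_d : m ≫ G.d = pullback.snd G.d G.c ≫ G.d := hθ.app_fst _ _ _ _ _
  have m_c : m ≫ G.c = pullback.fst G.d G.c ≫ G.c := hθ.app_snd _ _ _ _ _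
  { m := m
    m_d := m_d
    m_c := m_c
    m_one := hm₁ _ _ _ (by simp)
    one_m := h₁m _ _ _ (by simp)
    assoc := by
      intro T f g h hfg hgh
      let p := pullback.snd G.d G.c ≫ G.d
      let f₀ := pullback.fst p G.c ≫ pullback.fst G.d G.c
      let g₀ := pullback.fst p G.c ≫ pullback.snd G.d G.c
      let h₀ := pullback.snd p G.c
      have hfg₀ : f₀ ≫ G.d = g₀ ≫ G.c := by simp [f₀, g₀, pullback.condition]
      have hgh₀ : g₀ ≫ G.d = h₀ ≫ G.c := by
        simpa [p, g₀, h₀] using pullback.condition (f := p) (g := G.c)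
      have key : pullback.lift (pullback.lift f₀ g₀ hfg₀ ≫ m) h₀ (by simp [m_d, hgh₀]) ≫ m =
          pullback.lift f₀ (pullback.lift g₀ h₀ hgh₀ ≫ m) (by simp [m_c, hfg₀]) ≫ m := by
        -- Composable triples are generated by `(f, g, 1)` and `(1, 1, h)`, where associativity
        -- reduces to the unit laws.
        refine pullback_hom_ext_of_sections (s := pullback.lift G.e G.e (by rw [G.e_d, G.e_c]))
          (t := G.e) (by simp [p, G.e_d]) G.e_c ?_ ?_
        · have h₁ := hm₁ (pullback.snd G.d G.c) (pullback.snd G.d G.c ≫ G.d ≫ G.e)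
            (by simp [G.e_c]) rfl
          have h₂ := hm₁ m (pullback.snd G.d G.c ≫ G.d ≫ G.e)
            (by simp [G.e_c, m_d]) (by simp [reassoc_of% m_d])
          simp [hcomp, f₀, g₀, h₀, p, h₁, h₂]
        · have h₁ := h₁m (G.c ≫ G.e) (G.c ≫ G.e) (by simp [G.e_c, G.e_d])
            (by simp [reassoc_of% G.e_c])
          have h₂ := h₁m (G.c ≫ G.e) (𝟙 _) (by simp [G.e_d]) (by simp)
          simp [hcomp, f₀, g₀, h₀, p, h₁, h₂]
      have := pullback.lift (pullback.lift f g hfg) h (by simpa [p] using hgh) ≫= key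
      simpa [hcomp, f₀, g₀, h₀, p] using this
    inv := connectorApp θ (G.d ≫ G.e) (𝟙 _) (G.c ≫ G.e) (by simp [G.e_d]) (by simp [G.e_c])
    inv_d := by rw [hθ.app_fst, Category.assoc, G.e_d, Category.comp_id]
    inv_c := by rw [hθ.app_snd, Category.assoc, G.e_c, Category.comp_id]
    m_inv := by
      rw [hm]
      simpa using hθ.app_app_right (𝟙 _) (G.d ≫ G.e) (G.c ≫ G.e) (by simp [G.e_d]) (by simp [G.e_c])
    inv_m := by
      rw [hm]
      have h₁ := hθ.app_fst (G.d ≫ G.e) (𝟙 _) (G.c ≫ G.e) (by simp [G.e_d]) (by simp [G.e_c])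
      have := hθ.app_app_left (G.d ≫ G.e) (𝟙 _) (G.c ≫ G.e) (by simp [G.e_d]) (by simp [G.e_c])
      simpa [reassoc_of% h₁, reassoc_of% G.e_d] using this }

/-! ### Huq-commuting arrows -/

lemma HuqCommute.symm {X B Y : C} {f : X ⟶ Y} {g : B ⟶ Y} (h : HuqCommute f g) :
    HuqCommute g f := by
  obtain ⟨φ, rfl, rfl⟩ := h
  exact ⟨prod.lift prod.snd prod.fst ≫ φ, by simp [prod.comp_lift_assoc],
    by simp [prod.comp_lift_assoc]⟩

lemma HuqCommute.comp {X B X' B' Y : C} {f : X ⟶ Y} {g : B ⟶ Y} (h : HuqCommute f g)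
    (a : X' ⟶ X) (b : B' ⟶ B) : HuqCommute (a ≫ f) (b ≫ g) := by
  obtain ⟨φ, rfl, rfl⟩ := h
  exact ⟨prod.map a b ≫ φ, by simp [prod.comp_lift_assoc, prod.lift_map_assoc],
    by simp [prod.comp_lift_assoc, prod.lift_map_assoc]⟩

/-- An arrow which locally factors through `j` commutes with whatever `j` commutes with. -/
lemma HuqCommute.of_cover {T K X X' Y : C} {j : X ⟶ Y} {k : X' ⟶ Y} (h : HuqCommute j k)
    {i : K ⟶ Y} (t : T ⟶ K) [IsRegularEpi t] (y : T ⟶ X) (hy : y ≫ j = t ≫ i) :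
    HuqCommute i k := by
  obtain ⟨φ, rfl, rfl⟩ := h
  let p := pullback.snd t (prod.fst : K ⨯ X' ⟶ K)
  let ψ := prod.lift (pullback.fst t (prod.fst : K ⨯ X' ⟶ K) ≫ y) (p ≫ prod.snd) ≫ φ
  -- The cooperator exists on `T × X'` and must descend to `K × X'`. On the kernel of `p` it reduces
  -- to `y ≫ j = t ≫ i`, which vanishes there.
  obtain ⟨g, hg⟩ := exists_desc_of_kernel_comp p ψ (by
    have h₁ : kernel.ι p ≫ pullback.fst t (prod.fst : K ⨯ X' ⟶ K) ≫ t = 0 := by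
      rw [pullback.condition]
      exact kernel.condition_assoc _ _ |>.trans zero_comp
    have h₂ : kernel.ι p ≫ ψ =
        kernel.ι p ≫ pullback.fst t (prod.fst : K ⨯ X' ⟶ K) ≫ y ≫ prod.lift (𝟙 X) 0 ≫ φ := by
      simp [ψ, prod.comp_lift_assoc]
    rw [h₂, hy, reassoc_of% h₁, zero_comp])
  refine ⟨g, ?_, ?_⟩
  · have := pullback.lift (𝟙 T) (prod.lift t 0) (by simp) ≫= hg
    rw [← cancel_epi t, ← hy]
    simpa [p, ψ, prod.comp_lift_assoc] using this
  · have := pullback.lift 0 (prod.lift 0 (𝟙 X')) (by simp) ≫= hg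
    simpa [p, ψ, prod.comp_lift_assoc] using this

/-! ### The Peiffer arrow `φ` and commutation of the kernels of `d` and `c` -/

namespace Action

variable {B X : C} {ξ : Action B X} {δ : X ⟶ B} {φ : X ⨯ X ⟶ ξ.semidirect}

/-- Together with the next lemma: `φ(x, z)` is an arrow `δ x → δ z`. -/
lemma comp_d_of_peiffer (hk : prod.lift 0 (𝟙 X) ≫ φ = ξ.k)
    (he : prod.lift (𝟙 X) (𝟙 X) ≫ φ = δ ≫ ξ.e) : φ ≫ ξ.d = prod.fst ≫ δ := by
  apply prod_hom_ext_of_diag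
  · rw [reassoc_of% hk, k_d]
    simp
  · rw [reassoc_of% he, e_d]
    simp

lemma comp_c_of_peiffer (hk : prod.lift 0 (𝟙 X) ≫ φ = ξ.k)
    (he : prod.lift (𝟙 X) (𝟙 X) ≫ φ = δ ≫ ξ.e) {c : ξ.semidirect ⟶ B} (hc : ξ.e ≫ c = 𝟙 B)
    (hδ : ξ.k ≫ c = δ) : φ ≫ c = prod.snd ≫ δ := by
  apply prod_hom_ext_of_diag
  · rw [reassoc_of% hk, hδ]
    simp
  · rw [reassoc_of% he, hc]
    simp

/-- The arrow `(π₁, φ)` is an isomorphism from `X × X` to the pullback of `δ` and `d`. -/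
lemma exists_lift_comp_eq_of_peiffer (hk : prod.lift 0 (𝟙 X) ≫ φ = ξ.k)
    (he : prod.lift (𝟙 X) (𝟙 X) ≫ φ = δ ≫ ξ.e) {T : C} (x : T ⟶ X) (a : T ⟶ ξ.semidirect)
    (h : x ≫ δ = a ≫ ξ.d) : ∃ z : T ⟶ X, prod.lift x z ≫ φ = a := by
  let w : X ⨯ X ⟶ pullback δ ξ.d := pullback.lift prod.fst φ (comp_d_of_peiffer hk he).symm
  let k' : X ⟶ pullback δ ξ.d := pullback.lift 0 ξ.k (by rw [k_d, zero_comp])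
  have hk' : k' ≫ pullback.fst δ ξ.d = 0 := pullback.lift_fst _ _ _
  have hlim : IsLimit (KernelFork.ofι k' hk') :=
    KernelFork.IsLimit.ofι _ _
      (fun z hz => (ξ.exists_lift_k (z ≫ pullback.snd _ _)
        (by rw [Category.assoc, ← pullback.condition, reassoc_of% hz, zero_comp])).choose)
      (fun z hz => by
        have := (ξ.exists_lift_k (z ≫ pullback.snd _ _)
          (by rw [Category.assoc, ← pullback.condition, reassoc_of% hz, zero_comp])).choose_spec
        apply pullback.hom_ext
        · rw [Category.assoc, hk', comp_zero, hz]
        · rw [Category.assoc, pullback.lift_snd, this])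
      (fun z hz l hl => by
        rw [← cancel_mono ξ.k, (ξ.exists_lift_k (z ≫ pullback.snd _ _)
          (by rw [Category.assoc, ← pullback.condition, reassoc_of% hz, zero_comp])).choose_spec,
          ← hl, Category.assoc, pullback.lift_snd])
  -- Pulling `d` back along `δ` keeps the kernel `X`, so `w` compares two split extensions of `X` by
  -- `X`.
  have : IsIso w := splitShortFive (s := prod.lift (𝟙 X) (𝟙 X))
    (s' := pullback.lift (𝟙 X) (δ ≫ ξ.e) (by simp [e_d])) (x := 𝟙 X) (b := 𝟙 X) _
    ⟨isLimitKernelProdFst X X⟩ (prod.lift_fst _ _) hk' ⟨hlim⟩ (pullback.lift_fst _ _ _)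
    (by apply pullback.hom_ext <;> simp [w, k', hk]) (by simp [w])
    (by apply pullback.hom_ext <;> simp [w, he]) inferInstance inferInstance
  have hw₁ : inv w ≫ prod.fst = pullback.fst δ ξ.d := by simp [w]
  have hw₂ : inv w ≫ φ = pullback.snd δ ξ.d := by simp [w]
  refine ⟨pullback.lift x a h ≫ inv w ≫ prod.snd, ?_⟩
  have : prod.lift x (pullback.lift x a h ≫ inv w ≫ prod.snd) = pullback.lift x a h ≫ inv w := by
    apply Limits.prod.hom_ext <;> simp [hw₁]
  rw [this, Category.assoc, hw₂, pullback.lift_snd]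

/-- Over the kernel of `δ`, the arrow `φ` factors through its restriction to the first factor. -/
lemma exists_comp_lift_eq_of_peiffer (hk : prod.lift 0 (𝟙 X) ≫ φ = ξ.k)
    (he : prod.lift (𝟙 X) (𝟙 X) ≫ φ = δ ≫ ξ.e) {T : C} (x z : T ⟶ X) (hz : z ≫ δ = 0) :
    ∃ y : T ⟶ X, y ≫ prod.lift (𝟙 X) 0 ≫ φ = prod.lift x z ≫ φ := by
  let ι := kernel.ι δ
  have hι : ι ≫ δ = 0 := kernel.condition δ
  -- In groups `f(a, x) = x a⁻¹` for `a` in the kernel of `δ`; this is the substitute for inverses.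
  obtain ⟨f, hf⟩ := ξ.exists_lift_k (prod.map ι (𝟙 X) ≫ φ) (by
    rw [Category.assoc, comp_d_of_peiffer hk he, prod.map_fst_assoc, hι, comp_zero])
  have hr : prod.lift 0 (𝟙 X) ≫ f = 𝟙 X := by
    rw [← cancel_mono ξ.k, Category.assoc, hf, prod.lift_map_assoc]
    simp [hk]
  have hd : prod.lift (𝟙 _) ι ≫ f = 0 := by
    rw [← cancel_mono ξ.k, Category.assoc, hf, prod.lift_map_assoc]
    have := ι ≫= he
    rw [prod.comp_lift_assoc, reassoc_of% hι] at this
    simpa using this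
  -- In groups this says `b a b⁻¹ = a` on the kernel of `δ`. At `b = 0` it gives `φ(f(a, 0), 0) = k
  -- a`, the only nontrivial case of `key`.
  have hsub : prod.lift (prod.map (𝟙 _) ι ≫ f) (prod.snd ≫ ι) ≫ φ = prod.fst ≫ ι ≫ ξ.k := by
    apply prod_hom_ext_of_diag
    · have h₁ : prod.lift 0 ι ≫ f = ι := by
        have := ι ≫= hr
        rw [prod.comp_lift_assoc] at this
        simpa using this
      have h₂ : prod.lift ι ι ≫ φ = 0 := by
        have := ι ≫= he
        rw [prod.comp_lift_assoc, reassoc_of% hι] at this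
        simpa using this
      simp [prod.comp_lift_assoc, prod.lift_map_assoc, h₁, h₂]
    · have h₂ : prod.lift 0 ι ≫ φ = ι ≫ ξ.k := by
        rw [← hk, prod.comp_lift_assoc]
        simp
      simp [prod.comp_lift_assoc, prod.lift_map_assoc, hd, h₂]
  have key : prod.map (𝟙 X) ι ≫ φ =
      prod.lift prod.snd prod.fst ≫ f ≫ prod.lift (𝟙 X) 0 ≫ φ := by
    apply prod_hom_ext_of_inclusions
    · simp [prod.comp_lift_assoc, prod.lift_map_assoc, hr]
    · have h₁ := prod.lift (𝟙 _) 0 ≫= hsub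
      have h₂ : prod.lift 0 ι ≫ φ = ι ≫ ξ.k := by
        rw [← hk, prod.comp_lift_assoc]
        simp
      simpa [prod.comp_lift_assoc, prod.lift_map_assoc, h₂] using h₁.symm
  have h := prod.lift x (kernel.lift δ z hz) ≫= key
  refine ⟨prod.lift (kernel.lift δ z hz) x ≫ f, ?_⟩
  simpa [ι, prod.comp_lift_assoc, prod.lift_map_assoc] using h.symm

/-- The Peiffer condition implies that the kernels of `d` and `c` commute. -/
lemma huqCommute_of_peiffer (hk : prod.lift 0 (𝟙 X) ≫ φ = ξ.k)
    (he : prod.lift (𝟙 X) (𝟙 X) ≫ φ = δ ≫ ξ.e) {c : ξ.semidirect ⟶ B} (hc : ξ.e ≫ c = 𝟙 B)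
    (hδ : ξ.k ≫ c = δ) : HuqCommute ξ.k (kernel.ι c) := by
  obtain ⟨R, p, d', c', hp, hd', hc', ⟨⟨hR⟩⟩⟩ := exists_image_equivalenceRelation ξ.d c ξ.e ξ.e_d hc
  -- An arrow `a` with `c a = 0` relates `d a` to `0`. Symmetry of the image relation relates `0` to
  -- `d a`, so locally some `k x` satisfies `δ x = d a`.
  let ρ : kernel c ⟶ R := kernel.ι c ≫ p ≫ hR.s
  have hs₁ : hR.s ≫ d' = c' := hR.symmetry₁
  have hs₂ : hR.s ≫ c' = d' := hR.symmetry₂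
  have hρd : ρ ≫ d' = 0 := by simp [ρ, hs₁, hc']
  have hρc : ρ ≫ c' = kernel.ι c ≫ ξ.d := by simp [ρ, hs₂, hd']
  let t := pullback.fst ρ p
  obtain ⟨x, hx⟩ := ξ.exists_lift_k (pullback.snd ρ p) (by
    rw [← hd', ← pullback.condition_assoc, hρd, comp_zero])
  have hxδ : x ≫ δ = (t ≫ kernel.ι c) ≫ ξ.d := by
    have : pullback.snd ρ p ≫ p ≫ c' = t ≫ kernel.ι c ≫ ξ.d := by
      rw [← pullback.condition_assoc, hρc]
    rw [← hδ, reassoc_of% hx, Category.assoc, ← this, hc']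
  obtain ⟨z, hz⟩ := exists_lift_comp_eq_of_peiffer hk he x _ hxδ
  -- Since `a = φ(x, z)` lies in the kernel of `c`, also `δ z = 0`, and the second argument of `φ`
  -- can be absorbed into the first.
  obtain ⟨y, hy⟩ := exists_comp_lift_eq_of_peiffer hk he x z (by
    have := hz =≫ c
    rw [Category.assoc, comp_c_of_peiffer hk he hc hδ] at this
    simpa using this)
  have hjk : HuqCommute (prod.lift (𝟙 X) 0 ≫ φ) ξ.k := ⟨φ, rfl, hk⟩
  exact (hjk.of_cover t y (hy.trans hz)).symm

end Action

/-! ### From commuting kernels to connectors, and from groupoids to Peiffer arrows -/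

/-- Under the Smith-is-Huq condition, the kernel pairs of two parallel arrows have a connector
as soon as their kernels commute. -/
lemma SmithIsHuq.exists_isConnector (hSH : SmithIsHuq C) {A B : C} {d c : A ⟶ B}
    (h : HuqCommute (kernel.ι d) (kernel.ι c)) :
    ∃ θ : pullback (pullback.snd d d) (pullback.fst c c) ⟶ A, IsConnector θ := by
  have heff (f : A ⟶ B) :
      Nonempty (EffectiveEquivalenceRelation (pullback.fst f f) (pullback.snd f f)) :=
    (isEffective _ _ ((IsKernelPair.of_hasPullback f).equivalenceRelation f _ _
      (pullback.isLimit _ _)).isEquivalenceRelation).nonempty_effectiveEquivalenceRelation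
  obtain ⟨hR⟩ := heff d
  obtain ⟨hS⟩ := heff c
  -- A factorisation through the kernel suffices, as Huq-commutation is stable under precomposition.
  have hn (f : A ⟶ B) : ∃ a, normalisation (pullback.fst f f) (pullback.snd f f) =
      a ≫ kernel.ι f :=
    ⟨kernel.lift f (normalisation (pullback.fst f f) (pullback.snd f f)) (by
      rw [normalisation, Category.assoc, ← pullback.condition, kernel.condition_assoc, zero_comp]),
      by simp⟩
  refine SmithCommute.exists_isConnector ((hSH hR hS).2 ?_)
  obtain ⟨a, ha⟩ := hn d
  obtain ⟨b, hb⟩ := hn c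
  rw [ha, hb]
  exact h.comp a b

/-- In an internal groupoid on the reflexive graph of a precrossed module, the composite of
`k z` and the inverse of `k x` is a Peiffer arrow. -/
lemma IsInternalCrossedModule.exists_peiffer {X B : C} {δ : X ⟶ B} {ξ : Action B X}
    (h : IsInternalCrossedModule δ ξ) : ∃ φ : X ⨯ X ⟶ ξ.semidirect,
      prod.lift 0 (𝟙 X) ≫ φ = ξ.k ∧ prod.lift (𝟙 X) (𝟙 X) ≫ φ = δ ≫ ξ.e := by
  obtain ⟨c, hc, hδ, ⟨G⟩⟩ := h
  obtain ⟨m, -, -, m_one, -, -, i, -, i_c, m_inv, -⟩ := G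
  dsimp only at m m_one i_c m_inv
  refine ⟨pullback.lift (prod.snd ≫ ξ.k) (prod.fst ≫ ξ.k ≫ i)
    (by simp [i_c, ξ.k_d]) ≫ m, ?_, ?_⟩
  · have h₁ := ξ.k ≫= m_one
    rw [← Category.assoc] at h₁
    rw [← Category.assoc]
    refine Eq.trans (congrArg (· ≫ m) ?_) (h₁.trans (Category.comp_id _))
    apply pullback.hom_ext
    · simp
    · simp [reassoc_of% ξ.k_d]
  · have h₁ := ξ.k ≫= m_inv
    rw [← Category.assoc, reassoc_of% hδ] at h₁
    rw [← Category.assoc]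
    refine Eq.trans (congrArg (· ≫ m) ?_) h₁
    apply pullback.hom_ext <;> simp

end SemiAbelian

theorem mainTheorem1 {C : Type u} [Category.{v} C] [HasZeroMorphisms C] [SemiAbelian C]
    (hSH : SemiAbelian.SmithIsHuq C) {X B : C} (δ : X ⟶ B) (ξ : SemiAbelian.Action B X) :
    SemiAbelian.IsInternalCrossedModule δ ξ ↔
      ξ.commutator δ (𝟙 B) = ⊥ ∧
        (SemiAbelian.conjAction X).commutator ξ.k (δ ≫ ξ.e) = ⊥ := by
  rw [SemiAbelian.Action.commutator_eq_bot_iff, SemiAbelian.commutator_conjAction_eq_bot_iff]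
  constructor
  · intro h
    refine ⟨?_, h.exists_peiffer⟩
    obtain ⟨c, hc, hδ, -⟩ := h
    exact ⟨c, hδ, hc⟩
  · rintro ⟨⟨c, hδ, hc⟩, φ, hk, he⟩
    have hkd : ∃ a, kernel.ι ξ.d = a ≫ ξ.k := by
      obtain ⟨a, ha⟩ := ξ.exists_lift_k (kernel.ι ξ.d) (kernel.condition _)
      exact ⟨a, ha.symm⟩
    obtain ⟨a, ha⟩ := hkd
    have hH : SemiAbelian.HuqCommute (kernel.ι ξ.d) (kernel.ι c) := by
      have := (SemiAbelian.Action.huqCommute_of_peiffer hk he hc hδ).comp a (𝟙 _)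
      rwa [← ha, Category.id_comp] at this
    obtain ⟨θ, hθ⟩ := hSH.exists_isConnector hH
    exact ⟨c, hc, hδ, ⟨SemiAbelian.GroupoidStructure.ofConnector _ hθ⟩⟩
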